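/- For a complex matrix $A$ let $\|A\|_{\mathrm{Tr}}=\operatorname{Tr}\sqrt{A^\dagger A}$ be the trace norm, and let $\operatorname{Vec}(A)$ be the column vector obtained by stacking the columns of $A$. For a matrix $Z$ acting on $\mathbb{C}^{d_A}\otimes\mathbb{C}^{d_B}$, with blocks $Z_{i,j}\in\mathbb{C}^{d_B\times d_B}$ $(1\le i,j\le d_A)$, the realigned matrix $\mathcal{R}(Z)\in\mathbb{C}^{d_A^2\times d_B^2}$ is the matrix with rows $\operatorname{Vec}(Z_{1,1})^T,\dots,\operatorname{Vec}(Z_{d_A,1})^T,\dots,\operatorname{Vec}(Z_{1,d_A})^T,\dots,\operatorname{Vec}(Z_{d_A,d_A})^T$, in this order. For real vectors $\mu\in\mathbb{R}^n$ and $\nu\in\mathbb{R}^m$ (with Euclidean norms $|\mu|,|\nu|$) and a state $\rho$ on $\mathbb{C}^{d_A}\otimes\mathbb{C}^{d_B}$ with reduced states $\rho_A=\operatorname{Tr}_B\rho$ and $\rho_B=\operatorname{Tr}_A\rho$, put $$\mathcal{Q}_{\mu,\nu}(\rho)=\begin{pmatrix}\mu\nu^T & \mu\operatorname{Vec}(\rho_B)^T\\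 \operatorname{Vec}(\rho_A)\nu^T & \mathcal{R}(\rho)\end{pmatrix}.$$ For a state (density matrix) $\rho$ on $\mathbb{C}^d\otimes\mathbb{C}^d\otimes\mathbb{C}^d$ and $\{i,j,k\}=\{1,2,3\}$ let $\mathcal{Q}_{i|jk}(\rho)$ be the matrix $\mathcal{Q}_{\mu,\nu}(\rho)$ formed under the bipartition $i|jk$ (so that $A$ is the $i$-th subsystem and $B$ consists of the two others), and let $$\mathscr{Q}(\rho)=\tfrac13\left(\|\mathcal{Q}_{1|23}(\rho)\|_{\mathrm{Tr}}+\|\mathcal{Q}_{2|13}(\rho)\|_{\mathrm{Tr}}+\|\mathcal{Q}_{3|12}(\rho)\|_{\mathrm{Tr}}\right).$$ The state $\rho$ is called biseparable if it is a finite convex combination of projectors $|\varphi\rangle\langle\varphi|$ onto unit vectors, each of which is a product vector under at least one of the bipartitions $1|23$, $2|13$, $3|12$; otherwise $\rho$ is called genuinely tripartite entangled. **Theorem.** Let $\mu\in\mathbb{R}^n$, $\nu\in\mathbb{R}^m$, and let $\rho$ be a state on $\mathbb{C}^d\otimes\mathbb{C}^d\otimes\mathbb{C}^d$. If $\rho$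 is biseparable, then $$\mathscr{Q}(\rho)\le\sqrt{(|\mu|^2+1)(|\nu|^2+1)}+\frac{2(d-1)}{3}.$$ Consequently, if $\mathscr{Q}(\rho)>\sqrt{(|\mu|^2+1)(|\nu|^2+1)}+\frac{2(d-1)}{3}$, then $\rho$ is genuinely tripartite entangled. -/

import Mathlib

noncomputable section

namespace Tripartite

open scoped Matrix MatrixOrder ComplexOrder

/-- The trace norm `‖A‖_Tr = Tr √(A† A)` of a complex (possibly rectangular) matrix. The trace is
that of a positive semidefinite matrix, hence real. -/
def traceNorm {m n : Type*} [Fintype m] [Fintype n] [DecidableEq n] (A : Matrix m n ℂ) : ℝ :=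
  (CFC.sqrt (Aᴴ * A)).trace.re

/-- A state (density matrix): positive semidefinite with trace one. -/
def IsState {ι : Type*} [Fintype ι] (ρ : Matrix ι ι ℂ) : Prop :=
  ρ.PosSemidef ∧ ρ.trace = 1

/-- The rank-one operator `|φ⟩⟨φ|`. -/
def ketBra {ι : Type*} (φ : EuclideanSpace ℂ ι) : Matrix ι ι ℂ :=
  Matrix.of fun x y => φ x * star (φ y)

/-! ### Bipartite matrices -/

/-- The partial trace `Tr_A` over the first subsystem; `ρ_B = Tr_A ρ`. -/
def traceFst {α β : Type*} [Fintype α] (ρ : Matrix (α × β) (α × β) ℂ) : Matrix β β ℂ :=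
  Matrix.of fun k l => ∑ i, ρ (i, k) (i, l)

/-- The partial trace `Tr_B` over the second subsystem; `ρ_A = Tr_B ρ`. -/
def traceSnd {α β : Type*} [Fintype β] (ρ : Matrix (α × β) (α × β) ℂ) : Matrix α α ℂ :=
  Matrix.of fun i j => ∑ k, ρ (i, k) (j, k)

/-- The block `Z_{i,j}` of a bipartite matrix `Z`. -/
def block {α β : Type*} (Z : Matrix (α × β) (α × β) ℂ) (i j : α) : Matrix β β ℂ :=
  Matrix.of fun k l => Z (i, k) (j, l)

/-- The realigned matrix `R(Z)`: its rows are the `Vec(Z_{i,j})ᵀ`, ordered column by column. The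
index `p = (j, i)` of a row is the one which `Matrix.vec` (stacking of columns) gives to the
entry in row `i` and column `j`. -/
def realign {α β : Type*} (Z : Matrix (α × β) (α × β) ℂ) : Matrix (α × α) (β × β) ℂ :=
  Matrix.of fun p => (block Z p.2 p.1).vec

/-- The block matrix
`Q_{μ,ν}(ρ) = [[μ νᵀ, μ Vec(ρ_B)ᵀ], [Vec(ρ_A) νᵀ, R(ρ)]]`. -/
def Q {α β : Type*} [Fintype α] [Fintype β] {n m : ℕ}
    (μ : EuclideanSpace ℝ (Fin n)) (ν : EuclideanSpace ℝ (Fin m))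
    (ρ : Matrix (α × β) (α × β) ℂ) : Matrix (Fin n ⊕ α × α) (Fin m ⊕ β × β) ℂ :=
  Matrix.fromBlocks
    (Matrix.vecMulVec (fun a => (μ a : ℂ)) (fun b => (ν b : ℂ)))
    (Matrix.vecMulVec (fun a => (μ a : ℂ)) (traceFst ρ).vec)
    (Matrix.vecMulVec (traceSnd ρ).vec (fun b => (ν b : ℂ)))
    (realign ρ)

/-! ### Tripartite matrices

A vector or matrix on the tripartite system `1 2 3` is indexed by `α × β × γ = α × (β × γ)`. -/

section

variable {α β γ : Type*}

/-- A tripartite matrix, viewed as a bipartite one under the bipartition `1|23`. -/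
def cut1 (ρ : Matrix (α × β × γ) (α × β × γ) ℂ) : Matrix (α × (β × γ)) (α × (β × γ)) ℂ := ρ

/-- A tripartite matrix, viewed as a bipartite one under the bipartition `2|13`. -/
def cut2 (ρ : Matrix (α × β × γ) (α × β × γ) ℂ) : Matrix (β × (α × γ)) (β × (α × γ)) ℂ :=
  Matrix.of fun x y => ρ (x.2.1, x.1, x.2.2) (y.2.1, y.1, y.2.2)

/-- A tripartite matrix, viewed as a bipartite one under the bipartition `3|12`. -/
def cut3 (ρ : Matrix (α × β × γ) (α × β × γ) ℂ) : Matrix (γ × (α × β)) (γ × (α × β)) ℂ :=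
  Matrix.of fun x y => ρ (x.2.1, x.2.2, x.1) (y.2.1, y.2.2, y.1)

/-- `φ` is a product vector `|φ_1⟩ ⊗ |φ_23⟩` under the bipartition `1|23`. -/
def IsProduct1 (φ : EuclideanSpace ℂ (α × β × γ)) : Prop :=
  ∃ (χ : EuclideanSpace ℂ α) (ψ : EuclideanSpace ℂ (β × γ)),
    ∀ i j k, φ (i, j, k) = χ i * ψ (j, k)

/-- `φ` is a product vector under the bipartition `2|13`. -/
def IsProduct2 (φ : EuclideanSpace ℂ (α × β × γ)) : Prop :=
  ∃ (χ : EuclideanSpace ℂ β) (ψ : EuclideanSpace ℂ (α × γ)),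
    ∀ i j k, φ (i, j, k) = χ j * ψ (i, k)

/-- `φ` is a product vector under the bipartition `3|12`. -/
def IsProduct3 (φ : EuclideanSpace ℂ (α × β × γ)) : Prop :=
  ∃ (χ : EuclideanSpace ℂ γ) (ψ : EuclideanSpace ℂ (α × β)),
    ∀ i j k, φ (i, j, k) = χ k * ψ (i, j)

variable [Fintype α] [Fintype β] [Fintype γ]

/-- `ρ` is biseparable: it is a convex combination of pure states (projectors onto unit vectors)
each of which is a product under one of the bipartitions `1|23`, `2|13`, `3|12`. -/
def IsBiseparable (ρ : Matrix (α × β × γ) (α × β × γ) ℂ) : Prop :=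
  ∃ (a b c : ℕ) (p : Fin a → ℝ) (q : Fin b → ℝ) (r : Fin c → ℝ)
    (φ : Fin a → EuclideanSpace ℂ (α × β × γ))
    (ψ : Fin b → EuclideanSpace ℂ (α × β × γ))
    (ω : Fin c → EuclideanSpace ℂ (α × β × γ)),
    (∀ i, 0 ≤ p i ∧ ‖φ i‖ = 1 ∧ IsProduct1 (φ i)) ∧
    (∀ j, 0 ≤ q j ∧ ‖ψ j‖ = 1 ∧ IsProduct2 (ψ j)) ∧
    (∀ k, 0 ≤ r k ∧ ‖ω k‖ = 1 ∧ IsProduct3 (ω k)) ∧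
    ∑ i, p i + ∑ j, q j + ∑ k, r k = 1 ∧
    ρ = ∑ i, (p i : ℂ) • ketBra (φ i) + ∑ j, (q j : ℂ) • ketBra (ψ j)
      + ∑ k, (r k : ℂ) • ketBra (ω k)

/-- A state is genuinely tripartite entangled if it is not biseparable. -/
def IsGenuinelyEntangled (ρ : Matrix (α × β × γ) (α × β × γ) ℂ) : Prop :=
  IsState ρ ∧ ¬ IsBiseparable ρ

variable [DecidableEq α] [DecidableEq β] [DecidableEq γ]

/-- The average of the trace norms of `Q_{μ,ν}` under the three bipartitions. -/
def avgQ {n m : ℕ} (μ : EuclideanSpace ℝ (Fin n)) (ν : EuclideanSpace ℝ (Fin m))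
    (ρ : Matrix (α × β × γ) (α × β × γ) ℂ) : ℝ :=
  (1 / 3 : ℝ) * (traceNorm (Q μ ν (cut1 ρ)) + traceNorm (Q μ ν (cut2 ρ))
    + traceNorm (Q μ ν (cut3 ρ)))

end

end Tripartite

end

/-!
On states, `Q` is a two-sided linear transform of the realigned matrix, `Q(ρ) = V_μ R(ρ) V_νᵀ`,
where `V_μ` sends `Vec(σ)` to `(Tr(σ) μ, Vec(σ))`; hence its trace norm is convex on states. For a
pure state with Schmidt decomposition `∑ i, s i (e i ⊗ f i)`, the realigned matrix is the sum of the
rank-one matrices `s i s j Vec(|e i⟩⟨e j|) Vec(|f i⟩⟨f j|)ᵀ`. Since `|e i⟩⟨e j|` has trace `0` or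
`1`, the transform turns them into rank-one matrices of trace norm `s i s j C` for `i = j`, with
`C = √((|μ|² + 1) (|ν|² + 1))`, and `s i s j` for `i ≠ j`. As `∑ i, (s i)² = 1`, the trace norm of
`Q` is at most `C + (∑ i, s i)² - 1 ≤ C + (r - 1)`, where `r` is the number of terms, and `r = 1`
across a cut for which the vector is a product.
-/

namespace Tripartite

open scoped Matrix MatrixOrder ComplexOrder

section Outer

variable {l m n : Type*}

/-- The rank-one operator `|x⟩⟨y|`, as a matrix. -/
def outer (x : EuclideanSpace ℂ m) (y : EuclideanSpace ℂ n) : Matrix m n ℂ :=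
  Matrix.vecMulVec x (star y.ofLp)

lemma outer_apply (x : EuclideanSpace ℂ m) (y : EuclideanSpace ℂ n) (i : m) (j : n) :
    outer x y i j = x i * star (y j) :=
  rfl

lemma conjTranspose_outer (x : EuclideanSpace ℂ m) (y : EuclideanSpace ℂ n) :
    (outer x y)ᴴ = outer y x := by
  rw [outer, outer, Matrix.conjTranspose_vecMulVec, star_star]

lemma smul_outer (c : ℂ) (x : EuclideanSpace ℂ m) (y : EuclideanSpace ℂ n) :
    outer (c • x) y = c • outer x y :=
  Matrix.smul_vecMulVec c x.ofLp _

lemma zero_outer (y : EuclideanSpace ℂ n) : outer (0 : EuclideanSpace ℂ m) y = 0 :=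
  Matrix.zero_vecMulVec _

lemma posSemidef_outer_self [Finite n] (x : EuclideanSpace ℂ n) : (outer x x).PosSemidef :=
  Matrix.posSemidef_vecMulVec_self_star x.ofLp

variable [Fintype m]

lemma mul_outer (A : Matrix l m ℂ) (x : EuclideanSpace ℂ m) (y : EuclideanSpace ℂ n) :
    A * outer x y = outer (WithLp.toLp 2 (A *ᵥ x.ofLp)) y :=
  Matrix.mul_vecMulVec A x.ofLp _

lemma outer_mul_outer (x : EuclideanSpace ℂ l) (y z : EuclideanSpace ℂ m)
    (w : EuclideanSpace ℂ n) : outer x y * outer z w = inner ℂ y z • outer x w := by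
  rw [outer, outer, outer, Matrix.vecMulVec_mul_vecMulVec, Matrix.vecMulVec_smul,
    dotProduct_comm, ← EuclideanSpace.inner_eq_star_dotProduct]

lemma trace_outer (x y : EuclideanSpace ℂ m) : (outer x y).trace = inner ℂ y x :=
  Matrix.trace_vecMulVec x.ofLp _

lemma sum_outer_mul_sum_outer {ι : Type*} [Fintype ι] (s t : ι → ℝ) (x : ι → EuclideanSpace ℂ l)
    {u : ι → EuclideanSpace ℂ m} (hu : Orthonormal ℂ u) (y : ι → EuclideanSpace ℂ n) :
    (∑ i, s i • outer (x i) (u i)) * (∑ i, t i • outer (u i) (y i)) =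
      ∑ i, (s i * t i) • outer (x i) (y i) := by
  classical
  simp only [Matrix.sum_mul, Matrix.mul_sum, Matrix.smul_mul, Matrix.mul_smul, outer_mul_outer,
    orthonormal_iff_ite.1 hu, ite_smul, one_smul, zero_smul, smul_ite, smul_zero,
    Finset.sum_ite_eq', Finset.mem_univ, if_true, smul_smul, mul_comm]

lemma sum_outer_self_eq_one [DecidableEq m] {ι : Type*} [Fintype ι]
    (v : OrthonormalBasis ι ℂ (EuclideanSpace ℂ m)) : ∑ i, outer (v i) (v i) = 1 := by
  ext a b
  have h := congrArg (fun x => x.ofLp a) (v.sum_repr' (EuclideanSpace.single b (1 : ℂ)))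
  simpa [Matrix.sum_apply, outer_apply, Matrix.one_apply, EuclideanSpace.inner_single_right,
    mul_comm, Pi.single_apply] using h

end Outer

lemma orthonormal_normalize {ι E : Type*} [NormedAddCommGroup E] [InnerProductSpace ℂ E]
    {w : ι → E} (h0 : ∀ i, w i ≠ 0) (hw : Pairwise fun i j => inner ℂ (w i) (w j) = 0) :
    Orthonormal ℂ fun i => (‖w i‖ : ℂ)⁻¹ • w i := by
  refine ⟨fun i => norm_smul_inv_norm (h0 i), fun i j hij => ?_⟩
  simp only [inner_smul_left, inner_smul_right, hw hij, mul_zero]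

section SVD

variable {m n ι : Type*} [Fintype m] [Fintype n] [Fintype ι]

/-- `A = ∑ i, s i |u i⟩⟨v i|` is a singular value decomposition: the `u i` and the `v i` are
orthonormal families and the `s i` are nonnegative. Zero singular values may be left out. -/
structure IsSVD (A : Matrix m n ℂ) (s : ι → ℝ) (u : ι → EuclideanSpace ℂ m)
    (v : ι → EuclideanSpace ℂ n) : Prop where
  nonneg : ∀ i, 0 ≤ s i
  orthonormal_left : Orthonormal ℂ u
  orthonormal_right : Orthonormal ℂ v
  eq_sum : A = ∑ i, s i • outer (u i) (v i)

lemma exists_orthonormalBasis_pairwise_inner_mulVec_eq_zero (A : Matrix m n ℂ) :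
    ∃ v : OrthonormalBasis n ℂ (EuclideanSpace ℂ n), Pairwise fun i j =>
      inner ℂ (WithLp.toLp 2 (A *ᵥ (v i).ofLp)) (WithLp.toLp 2 (A *ᵥ (v j).ofLp)) = 0 := by
  classical
  have hA : (Aᴴ * A).IsHermitian := Matrix.isHermitian_conjTranspose_mul_self A
  refine ⟨hA.eigenvectorBasis, fun i j hij => ?_⟩
  beta_reduce
  rw [EuclideanSpace.inner_toLp_toLp, Matrix.star_mulVec, dotProduct_comm,
    ← Matrix.dotProduct_mulVec, Matrix.mulVec_mulVec, hA.mulVec_eigenvectorBasis j,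
    dotProduct_smul, dotProduct_comm, ← EuclideanSpace.inner_eq_star_dotProduct,
    hA.eigenvectorBasis.inner_eq_zero hij, smul_zero]

theorem exists_isSVD (A : Matrix m n ℂ) :
    ∃ (S : Finset n) (s : S → ℝ) (u : S → EuclideanSpace ℂ m) (v : S → EuclideanSpace ℂ n),
      IsSVD A s u v := by
  classical
  obtain ⟨v, hv⟩ := exists_orthonormalBasis_pairwise_inner_mulVec_eq_zero A
  let w : n → EuclideanSpace ℂ m := fun i => WithLp.toLp 2 (A *ᵥ (v i).ofLp)
  let S : Finset n := {i | w i ≠ 0}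
  have hS (i : S) : w i ≠ 0 := (Finset.mem_filter.1 i.2).2
  refine ⟨S, fun i => ‖w i‖, fun i => (‖w i‖ : ℂ)⁻¹ • w i, fun i => v i,
    fun i => norm_nonneg _, orthonormal_normalize hS (hv.comp_of_injective Subtype.val_injective),
    v.orthonormal.comp _ Subtype.val_injective, ?_⟩
  calc A = ∑ i, outer (w i) (v i) := by
        simp only [w, ← mul_outer, ← Matrix.mul_sum, sum_outer_self_eq_one, Matrix.mul_one]
    _ = ∑ i ∈ S, outer (w i) (v i) := by
        refine (Finset.sum_subset S.subset_univ fun i _ hi => ?_).symm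
        have hwi : w i = 0 := by simpa [S] using hi
        rw [hwi, zero_outer]
    _ = ∑ i : S, ‖w i‖ • outer ((‖w i‖ : ℂ)⁻¹ • w i) (v i) := by
        rw [← Finset.sum_coe_sort]
        refine Finset.sum_congr rfl fun i _ => ?_
        rw [← Complex.coe_smul, ← smul_outer, smul_inv_smul₀ (by simpa using hS i)]

lemma IsSVD.conjTranspose {A : Matrix m n ℂ} {s : ι → ℝ} {u : ι → EuclideanSpace ℂ m}
    {v : ι → EuclideanSpace ℂ n} (h : IsSVD A s u v) : IsSVD Aᴴ s v u where
  nonneg := h.nonneg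
  orthonormal_left := h.orthonormal_right
  orthonormal_right := h.orthonormal_left
  eq_sum := by simp [h.eq_sum, Matrix.conjTranspose_sum, conjTranspose_outer]

end SVD

section TraceNorm

variable {m n ι : Type*} [Fintype m] [Fintype n] [Fintype ι] [DecidableEq n]

lemma traceNorm_eq_re_trace {A : Matrix m n ℂ} {P : Matrix n n ℂ} (hP : P.PosSemidef)
    (h : P * P = Aᴴ * A) : traceNorm A = P.trace.re := by
  rw [traceNorm, CFC.sqrt_unique h hP.nonneg]

lemma traceNorm_smul (c : ℂ) (A : Matrix m n ℂ) : traceNorm (c • A) = ‖c‖ * traceNorm A := by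
  have hA : 0 ≤ Aᴴ * A := (Matrix.posSemidef_conjTranspose_mul_self A).nonneg
  have hP : ((‖c‖ : ℂ) • CFC.sqrt (Aᴴ * A)).PosSemidef :=
    (Matrix.nonneg_iff_posSemidef.1 (CFC.sqrt_nonneg _)).smul (by simp)
  have hsq : ((‖c‖ : ℂ) • CFC.sqrt (Aᴴ * A)) * ((‖c‖ : ℂ) • CFC.sqrt (Aᴴ * A)) =
      (c • A)ᴴ * (c • A) := by
    rw [Matrix.conjTranspose_smul, Matrix.smul_mul, Matrix.mul_smul, Matrix.smul_mul,
      Matrix.mul_smul, CFC.sqrt_mul_sqrt_self _ hA, smul_smul, smul_smul, Complex.star_def,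
      Complex.conj_mul', sq]
  rw [traceNorm_eq_re_trace hP hsq, Matrix.trace_smul, smul_eq_mul, Complex.re_ofReal_mul,
    traceNorm]

lemma traceNorm_outer (x : EuclideanSpace ℂ m) (y : EuclideanSpace ℂ n) :
    traceNorm (outer x y) = ‖x‖ * ‖y‖ := by
  have hP : ((‖x‖ / ‖y‖) • outer y y).PosSemidef :=
    (posSemidef_outer_self y).smul (by positivity)
  have hsq : ((‖x‖ / ‖y‖) • outer y y) * ((‖x‖ / ‖y‖) • outer y y) =
      (outer x y)ᴴ * outer x y := by
    rcases eq_or_ne y 0 with rfl | hy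
    · rw [conjTranspose_outer, zero_outer, zero_outer, smul_zero, zero_mul, Matrix.zero_mul]
    · rw [conjTranspose_outer, smul_mul_smul_comm, outer_mul_outer, outer_mul_outer,
        inner_self_eq_norm_sq_to_K, inner_self_eq_norm_sq_to_K, ← Complex.coe_smul, smul_smul]
      congr 1
      have : (‖y‖ : ℂ) ≠ 0 := by simpa using hy
      push_cast [Complex.coe_algebraMap]
      field_simp
  rw [traceNorm_eq_re_trace hP hsq, Matrix.trace_smul, trace_outer, Complex.smul_re,
    smul_eq_mul, ← RCLike.re_eq_complex_re, inner_self_eq_norm_sq]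
  rcases eq_or_ne y 0 with rfl | hy
  · simp
  · have : ‖y‖ ≠ 0 := norm_ne_zero_iff.2 hy
    field_simp

lemma traceNorm_vecMulVec (x : m → ℂ) (y : n → ℂ) :
    traceNorm (Matrix.vecMulVec x y) = ‖WithLp.toLp 2 x‖ * ‖WithLp.toLp 2 y‖ := by
  have hy : ‖WithLp.toLp 2 (star y)‖ = ‖WithLp.toLp 2 y‖ := by
    simp [EuclideanSpace.norm_eq]
  rw [← hy, ← traceNorm_outer, outer, star_star]

lemma IsSVD.traceNorm_eq {A : Matrix m n ℂ} {s : ι → ℝ} {u : ι → EuclideanSpace ℂ m}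
    {v : ι → EuclideanSpace ℂ n} (h : IsSVD A s u v) : traceNorm A = ∑ i, s i := by
  have hP : (∑ i, s i • outer (v i) (v i)).PosSemidef :=
    Matrix.posSemidef_sum _ fun i _ => (posSemidef_outer_self _).smul (h.nonneg i)
  have hsq : (∑ i, s i • outer (v i) (v i)) * ∑ i, s i • outer (v i) (v i) = Aᴴ * A := by
    rw [h.conjTranspose.eq_sum, sum_outer_mul_sum_outer _ _ _ h.orthonormal_right]
    conv_rhs => rw [h.eq_sum]
    rw [sum_outer_mul_sum_outer _ _ _ h.orthonormal_left]
  rw [traceNorm_eq_re_trace hP hsq]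
  simp [Matrix.trace_sum, trace_outer, h.orthonormal_right.1]

lemma traceNorm_nonneg (A : Matrix m n ℂ) : 0 ≤ traceNorm A := by
  obtain ⟨S, s, u, v, h⟩ := exists_isSVD A
  rw [h.traceNorm_eq]
  exact Finset.sum_nonneg fun i _ => h.nonneg i

open scoped Matrix.Norms.L2Operator

theorem norm_trace_conjTranspose_mul_le (B A : Matrix m n ℂ) :
    ‖(Bᴴ * A).trace‖ ≤ ‖B‖ * traceNorm A := by
  classical
  obtain ⟨S, s, u, v, h⟩ := exists_isSVD A
  rw [h.traceNorm_eq, Finset.mul_sum]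
  conv_lhs => rw [h.eq_sum, Matrix.mul_sum, Matrix.trace_sum]
  refine norm_sum_le_of_le _ fun i _ => ?_
  rw [Matrix.mul_smul, Matrix.trace_smul, mul_outer, trace_outer, norm_smul,
    Real.norm_of_nonneg (h.nonneg i), mul_comm, ← Matrix.l2_opNorm_conjTranspose]
  refine mul_le_mul_of_nonneg_right ?_ (h.nonneg i)
  calc ‖inner ℂ (v i) (WithLp.toLp 2 (Bᴴ *ᵥ (u i).ofLp))‖
      ≤ ‖v i‖ * ‖WithLp.toLp 2 (Bᴴ *ᵥ (u i).ofLp)‖ := norm_inner_le_norm _ _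
    _ ≤ ‖v i‖ * (‖Bᴴ‖ * ‖u i‖) := by gcongr; exact Matrix.l2_opNorm_mulVec Bᴴ (u i)
    _ = ‖Bᴴ‖ := by rw [h.orthonormal_left.1, h.orthonormal_right.1, one_mul, mul_one]

lemma norm_sum_outer_le_one {u : ι → EuclideanSpace ℂ m} {v : ι → EuclideanSpace ℂ n}
    (hu : Orthonormal ℂ u) (hv : Orthonormal ℂ v) : ‖∑ i, outer (u i) (v i)‖ ≤ 1 := by
  let P : Matrix n n ℂ := ∑ i, outer (v i) (v i)
  have hP : IsStarProjection P := by
    refine ⟨?_, ?_⟩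
    · simpa [P, IsIdempotentElem] using sum_outer_mul_sum_outer 1 1 v hv v
    · simp [P, IsSelfAdjoint, Matrix.star_eq_conjTranspose, conjTranspose_outer]
  have hBB : (∑ i, outer (u i) (v i))ᴴ * ∑ i, outer (u i) (v i) = P := by
    simpa [P, Matrix.conjTranspose_sum, conjTranspose_outer] using
      sum_outer_mul_sum_outer 1 1 v hu v
  refine abs_le_one_iff_mul_self_le_one.2 ?_ |>.trans' (le_abs_self _)
  rw [← Matrix.l2_opNorm_conjTranspose_mul_self, hBB]
  exact hP.norm_le

-- The maximizer `B` is the partial isometry of the polar decomposition of `A`.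
theorem exists_norm_le_one_trace_eq_traceNorm (A : Matrix m n ℂ) :
    ∃ B : Matrix m n ℂ, ‖B‖ ≤ 1 ∧ (Bᴴ * A).trace = traceNorm A := by
  obtain ⟨S, s, u, v, h⟩ := exists_isSVD A
  have hBA : (∑ i, outer (u i) (v i))ᴴ * A = ∑ i, s i • outer (v i) (v i) := by
    conv_lhs => rw [h.eq_sum]
    simpa [Matrix.conjTranspose_sum, conjTranspose_outer] using
      sum_outer_mul_sum_outer 1 s v h.orthonormal_left v
  refine ⟨∑ i, outer (u i) (v i), norm_sum_outer_le_one h.orthonormal_left h.orthonormal_right, ?_⟩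
  rw [hBA, h.traceNorm_eq]
  simp [Matrix.trace_sum, trace_outer, h.orthonormal_right.1]

theorem traceNorm_sum_le (A : ι → Matrix m n ℂ) :
    traceNorm (∑ i, A i) ≤ ∑ i, traceNorm (A i) := by
  obtain ⟨B, hB, hBA⟩ := exists_norm_le_one_trace_eq_traceNorm (∑ i, A i)
  have hnorm : traceNorm (∑ i, A i) = ‖(Bᴴ * ∑ i, A i).trace‖ := by
    rw [hBA, Complex.norm_real, Real.norm_of_nonneg (traceNorm_nonneg _)]
  rw [hnorm, Matrix.mul_sum, Matrix.trace_sum]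
  refine norm_sum_le_of_le _ fun i _ => (norm_trace_conjTranspose_mul_le B (A i)).trans ?_
  exact mul_le_of_le_one_left (traceNorm_nonneg _) hB

end TraceNorm

section Schmidt

variable {α β ι : Type*}

/-- The tensor product of two vectors, in coordinates. -/
def tensorVec (χ : EuclideanSpace ℂ α) (ψ : EuclideanSpace ℂ β) : EuclideanSpace ℂ (α × β) :=
  WithLp.toLp 2 fun p => χ p.1 * ψ p.2

variable [Fintype α] [Fintype β]

lemma inner_tensorVec (χ χ' : EuclideanSpace ℂ α) (ψ ψ' : EuclideanSpace ℂ β) :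
    inner ℂ (tensorVec χ ψ) (tensorVec χ' ψ') = inner ℂ χ χ' * inner ℂ ψ ψ' := by
  simp only [PiLp.inner_apply, tensorVec, RCLike.inner_apply, map_mul, Fintype.sum_prod_type,
    Finset.sum_mul_sum]
  exact Finset.sum_congr rfl fun _ _ => Finset.sum_congr rfl fun _ _ => mul_mul_mul_comm _ _ _ _

lemma orthonormal_tensorVec {e : ι → EuclideanSpace ℂ α} {f : ι → EuclideanSpace ℂ β}
    (he : Orthonormal ℂ e) (hf : Orthonormal ℂ f) :
    Orthonormal ℂ fun i => tensorVec (e i) (f i) := by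
  classical
  rw [orthonormal_iff_ite] at *
  intro i j
  rw [inner_tensorVec, he, hf]
  split_ifs <;> simp

lemma orthonormal_star {v : ι → EuclideanSpace ℂ α} (hv : Orthonormal ℂ v) :
    Orthonormal ℂ fun i => (WithLp.toLp 2 (star (v i).ofLp) : EuclideanSpace ℂ α) := by
  classical
  rw [orthonormal_iff_ite] at *
  intro i j
  rw [EuclideanSpace.inner_toLp_toLp, star_star, dotProduct_comm,
    ← EuclideanSpace.inner_eq_star_dotProduct, hv]
  exact if_congr eq_comm rfl rfl

variable [Fintype ι]

/-- `φ = ∑ i, s i (e i ⊗ f i)` is a Schmidt decomposition: the `e i` and the `f i` are orthonormal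
families and the `s i` are nonnegative. Zero Schmidt coefficients may be left out. -/
structure IsSchmidt (φ : EuclideanSpace ℂ (α × β)) (s : ι → ℝ) (e : ι → EuclideanSpace ℂ α)
    (f : ι → EuclideanSpace ℂ β) : Prop where
  nonneg : ∀ i, 0 ≤ s i
  orthonormal_left : Orthonormal ℂ e
  orthonormal_right : Orthonormal ℂ f
  eq_sum : φ = ∑ i, s i • tensorVec (e i) (f i)

theorem exists_isSchmidt (φ : EuclideanSpace ℂ (α × β)) :
    ∃ (S : Finset α) (s : S → ℝ) (e : S → EuclideanSpace ℂ α) (f : S → EuclideanSpace ℂ β),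
      IsSchmidt φ s e f := by
  obtain ⟨S, s, u, v, h⟩ := exists_isSVD (Matrix.of fun b a => φ (a, b))
  refine ⟨S, s, _, u, h.nonneg, orthonormal_star h.orthonormal_right, h.orthonormal_left, ?_⟩
  ext ⟨a, b⟩
  have hab : φ (a, b) = (∑ i, s i • outer (u i) (v i)) b a := congrFun₂ h.eq_sum b a
  simp [hab, tensorVec, Matrix.sum_apply, outer_apply, mul_comm]

lemma isSchmidt_tensorVec {χ : EuclideanSpace ℂ α} {ψ : EuclideanSpace ℂ β} (hχ : χ ≠ 0)
    (hψ : ψ ≠ 0) :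
    IsSchmidt (tensorVec χ ψ) (fun _ : Unit => ‖χ‖ * ‖ψ‖) (fun _ => (‖χ‖ : ℂ)⁻¹ • χ)
      (fun _ => (‖ψ‖ : ℂ)⁻¹ • ψ) where
  nonneg _ := by positivity
  orthonormal_left := orthonormal_normalize (fun _ => hχ) Subsingleton.pairwise
  orthonormal_right := orthonormal_normalize (fun _ => hψ) Subsingleton.pairwise
  eq_sum := by
    have : (‖χ‖ : ℂ) ≠ 0 := by simpa using hχ
    have : (‖ψ‖ : ℂ) ≠ 0 := by simpa using hψ
    ext p
    simp only [tensorVec, Finset.univ_unique, PiLp.smul_apply, smul_eq_mul, Finset.sum_const,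
      Finset.card_singleton, one_smul, Complex.real_smul, Complex.ofReal_mul]
    field_simp

lemma IsSchmidt.sum_sq_eq_norm_sq {φ : EuclideanSpace ℂ (α × β)} {s : ι → ℝ}
    {e : ι → EuclideanSpace ℂ α} {f : ι → EuclideanSpace ℂ β} (h : IsSchmidt φ s e f) :
    ∑ i, s i ^ 2 = ‖φ‖ ^ 2 := by
  have horth := orthonormal_tensorVec h.orthonormal_left h.orthonormal_right
  have hinner := horth.inner_sum (fun i => (s i : ℂ)) (fun i => (s i : ℂ)) Finset.univ
  simp only [Complex.coe_smul, ← h.eq_sum, inner_self_eq_norm_sq_to_K, Complex.conj_ofReal,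
    ← sq] at hinner
  exact Complex.ofReal_injective (by push_cast; exact hinner.symm)

lemma IsSchmidt.sq_sum_le {φ : EuclideanSpace ℂ (α × β)} {s : ι → ℝ}
    {e : ι → EuclideanSpace ℂ α} {f : ι → EuclideanSpace ℂ β} (h : IsSchmidt φ s e f) :
    (∑ i, s i) ^ 2 ≤ Fintype.card ι * ‖φ‖ ^ 2 := by
  rw [← h.sum_sq_eq_norm_sq]
  exact sq_sum_le_card_mul_sum_sq

end Schmidt

section Realignment

variable {α β ι : Type*}

lemma ketBra_eq_outer (φ : EuclideanSpace ℂ ι) : ketBra φ = outer φ φ :=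
  rfl

lemma trace_ketBra [Fintype ι] (φ : EuclideanSpace ℂ ι) : (ketBra φ).trace = ‖φ‖ ^ 2 :=
  (trace_outer φ φ).trans (inner_self_eq_norm_sq_to_K φ)

lemma realign_apply (Z : Matrix (α × β) (α × β) ℂ) (p : α × α) (q : β × β) :
    realign Z p q = Z (p.2, q.2) (p.1, q.1) :=
  rfl

lemma realign_smul (c : ℂ) (Z : Matrix (α × β) (α × β) ℂ) : realign (c • Z) = c • realign Z :=
  rfl

lemma realign_sum [Fintype ι] (Z : ι → Matrix (α × β) (α × β) ℂ) :
    realign (∑ i, Z i) = ∑ i, realign (Z i) := by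
  ext p q
  simp only [realign_apply, Matrix.sum_apply]

lemma vec_one_vecMul_realign [Fintype α] [DecidableEq α] (ρ : Matrix (α × β) (α × β) ℂ) :
    (1 : Matrix α α ℂ).vec ᵥ* realign ρ = (traceFst ρ).vec := by
  ext ⟨b', b⟩
  simp [Matrix.vecMul, dotProduct, realign_apply, traceFst, Matrix.vec, Matrix.one_apply,
    Fintype.sum_prod_type]

lemma realign_mulVec_vec_one [Fintype β] [DecidableEq β] (ρ : Matrix (α × β) (α × β) ℂ) :
    realign ρ *ᵥ (1 : Matrix β β ℂ).vec = (traceSnd ρ).vec := by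
  ext ⟨a', a⟩
  simp [Matrix.mulVec, dotProduct, realign_apply, traceSnd, Matrix.vec, Matrix.one_apply,
    Fintype.sum_prod_type]

variable [Fintype α] [Fintype β]

lemma IsSchmidt.realign_ketBra [Fintype ι] {φ : EuclideanSpace ℂ (α × β)} {s : ι → ℝ}
    {e : ι → EuclideanSpace ℂ α} {f : ι → EuclideanSpace ℂ β} (h : IsSchmidt φ s e f) :
    realign (ketBra φ) = ∑ i, ∑ j, ((s i * s j : ℝ) : ℂ) •
      Matrix.vecMulVec (outer (e i) (e j)).vec (outer (f i) (f j)).vec := by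
  ext ⟨a', a⟩ ⟨b', b⟩
  have hφ (x : α) (y : β) : φ (x, y) = ∑ i, s i * (e i x * f i y) := by
    simp [h.eq_sum, tensorVec]
  simp only [realign_apply, ketBra_eq_outer, outer_apply, hφ, star_sum, Finset.sum_mul_sum,
    Matrix.sum_apply, Matrix.smul_apply, Matrix.vecMulVec_apply, Matrix.vec, smul_eq_mul,
    star_mul', Complex.star_def, Complex.conj_ofReal, Complex.ofReal_mul]
  exact Finset.sum_congr rfl fun _ _ => Finset.sum_congr rfl fun _ _ => by ring

lemma trace_traceFst (ρ : Matrix (α × β) (α × β) ℂ) : (traceFst ρ).trace = ρ.trace := by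
  simp only [Matrix.trace, traceFst, Matrix.diag, Matrix.of_apply, Fintype.sum_prod_type_right]

lemma vec_one_dotProduct_vec [DecidableEq α] (σ : Matrix α α ℂ) :
    (1 : Matrix α α ℂ).vec ⬝ᵥ σ.vec = σ.trace := by
  simp [Matrix.vec_dotProduct_vec]

variable [DecidableEq α] [DecidableEq β] {n m : ℕ}

/-- The matrix of the linear map `Vec(σ) ↦ (Tr(σ) μ, Vec(σ))`. It turns the realigned matrix
into `Q`, see `Q_eq_augment_mul_realign_mul`. -/
def augment (α : Type*) [DecidableEq α] (μ : EuclideanSpace ℝ (Fin n)) :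
    Matrix (Fin n ⊕ α × α) (α × α) ℂ :=
  Matrix.fromRows (Matrix.vecMulVec (fun a => (μ a : ℂ)) (1 : Matrix α α ℂ).vec) 1

lemma augment_mulVec_vec (μ : EuclideanSpace ℝ (Fin n)) (σ : Matrix α α ℂ) :
    augment α μ *ᵥ σ.vec = Sum.elim (fun a => σ.trace * μ a) σ.vec := by
  rw [augment, Matrix.fromRows_mulVec, Matrix.vecMulVec_mulVec, Matrix.one_mulVec,
    vec_one_dotProduct_vec, op_smul_eq_smul]
  rfl

lemma Q_eq_augment_mul_realign_mul (μ : EuclideanSpace ℝ (Fin n)) (ν : EuclideanSpace ℝ (Fin m))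
    {ρ : Matrix (α × β) (α × β) ℂ} (hρ : ρ.trace = 1) :
    Q μ ν ρ = augment α μ * realign ρ * (augment β ν)ᵀ := by
  have hcorner : (traceFst ρ).vec ⬝ᵥ (1 : Matrix β β ℂ).vec = 1 := by
    rw [dotProduct_comm, vec_one_dotProduct_vec, trace_traceFst, hρ]
  rw [augment, augment, Matrix.fromRows_mul, Matrix.vecMulVec_mul, vec_one_vecMul_realign,
    Matrix.one_mul, Matrix.transpose_fromRows, Matrix.fromRows_mul_fromCols,
    Matrix.transpose_vecMulVec, Matrix.vecMulVec_mul_vecMulVec, Matrix.mul_vecMulVec,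
    realign_mulVec_vec_one, hcorner, one_smul, Matrix.transpose_one, Matrix.mul_one,
    Matrix.mul_one, Q]

lemma norm_augment_mulVec_vec_outer_sq (μ : EuclideanSpace ℝ (Fin n)) (x y : EuclideanSpace ℂ α) :
    ‖WithLp.toLp 2 (augment α μ *ᵥ (outer x y).vec)‖ ^ 2 =
      ‖inner ℂ y x‖ ^ 2 * ‖μ‖ ^ 2 + ‖x‖ ^ 2 * ‖y‖ ^ 2 := by
  rw [augment_mulVec_vec, trace_outer]
  simp only [EuclideanSpace.norm_sq_eq, Fintype.sum_sum_type, Sum.elim_inl, Sum.elim_inr,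
    norm_mul, mul_pow, Finset.mul_sum, Finset.sum_mul, Complex.norm_real]
  congr 1
  rw [Fintype.sum_prod_type]
  simp only [Matrix.vec, outer_apply, norm_mul, norm_star, mul_pow]

end Realignment

section Bipartite

variable {α β ι : Type*} [Fintype α] [Fintype β] [DecidableEq β] {n m : ℕ}
  (μ : EuclideanSpace ℝ (Fin n)) (ν : EuclideanSpace ℝ (Fin m))

lemma norm_augment_mulVec_vec_outer [DecidableEq α] [DecidableEq ι] {e : ι → EuclideanSpace ℂ α}
    (he : Orthonormal ℂ e) (i j : ι) :
    ‖WithLp.toLp 2 (augment α μ *ᵥ (outer (e i) (e j)).vec)‖ =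
      if i = j then √(‖μ‖ ^ 2 + 1) else 1 := by
  rw [← sq_eq_sq₀ (norm_nonneg _) (by positivity), norm_augment_mulVec_vec_outer_sq,
    orthonormal_iff_ite.1 he, he.1 i, he.1 j]
  rcases eq_or_ne i j with rfl | hij
  · simp only [if_true, norm_one, one_pow, one_mul, Real.sq_sqrt (by positivity : 0 ≤ ‖μ‖ ^ 2 + 1)]
  · simp [hij, hij.symm]

lemma traceNorm_augment_mul_vecMulVec_mul [DecidableEq α] [DecidableEq ι]
    {e : ι → EuclideanSpace ℂ α} {f : ι → EuclideanSpace ℂ β} (he : Orthonormal ℂ e)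
    (hf : Orthonormal ℂ f) (i j : ι) :
    traceNorm (augment α μ *
        Matrix.vecMulVec (outer (e i) (e j)).vec (outer (f i) (f j)).vec * (augment β ν)ᵀ) =
      if i = j then √((‖μ‖ ^ 2 + 1) * (‖ν‖ ^ 2 + 1)) else 1 := by
  rw [Matrix.mul_vecMulVec, Matrix.vecMulVec_mul, Matrix.vecMul_transpose, traceNorm_vecMulVec,
    norm_augment_mulVec_vec_outer μ he, norm_augment_mulVec_vec_outer ν hf,
    Real.sqrt_mul (by positivity)]
  split_ifs
  · rfl
  · exact one_mul 1

variable [Fintype ι]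

theorem traceNorm_Q_sum_le {p : ι → ℝ} (hp : ∀ i, 0 ≤ p i) (hsum : ∑ i, p i = 1)
    {σ : ι → Matrix (α × β) (α × β) ℂ} (hσ : ∀ i, (σ i).trace = 1) :
    traceNorm (Q μ ν (∑ i, (p i : ℂ) • σ i)) ≤ ∑ i, p i * traceNorm (Q μ ν (σ i)) := by
  classical
  have htrace : (∑ i, (p i : ℂ) • σ i).trace = 1 := by
    simp only [Matrix.trace_sum, Matrix.trace_smul, hσ, smul_eq_mul, mul_one]
    exact_mod_cast hsum
  have hQ : Q μ ν (∑ i, (p i : ℂ) • σ i) = ∑ i, (p i : ℂ) • Q μ ν (σ i) := by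
    simp only [Q_eq_augment_mul_realign_mul μ ν htrace, Q_eq_augment_mul_realign_mul μ ν (hσ _),
      realign_sum, realign_smul, Matrix.mul_sum, Matrix.sum_mul, Matrix.mul_smul, Matrix.smul_mul]
  rw [hQ]
  refine (traceNorm_sum_le _).trans_eq (Finset.sum_congr rfl fun i _ => ?_)
  rw [traceNorm_smul, Complex.norm_real, Real.norm_of_nonneg (hp i)]

theorem IsSchmidt.traceNorm_Q_ketBra_le {φ : EuclideanSpace ℂ (α × β)} {s : ι → ℝ}
    {e : ι → EuclideanSpace ℂ α} {f : ι → EuclideanSpace ℂ β} (h : IsSchmidt φ s e f)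
    (hφ : ‖φ‖ = 1) :
    traceNorm (Q μ ν (ketBra φ)) ≤
      √((‖μ‖ ^ 2 + 1) * (‖ν‖ ^ 2 + 1)) + (Fintype.card ι - 1) := by
  classical
  set C := √((‖μ‖ ^ 2 + 1) * (‖ν‖ ^ 2 + 1))
  have htrace : (ketBra φ).trace = 1 := by simp [trace_ketBra, hφ]
  have hsq : ∑ i, s i ^ 2 = 1 := by rw [h.sum_sq_eq_norm_sq, hφ, one_pow]
  have hcard : (∑ i, s i) ^ 2 ≤ Fintype.card ι := by simpa [hφ] using h.sq_sum_le
  have hterm (i j : ι) : traceNorm (((s i * s j : ℝ) : ℂ) • (augment α μ *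
        Matrix.vecMulVec (outer (e i) (e j)).vec (outer (f i) (f j)).vec * (augment β ν)ᵀ)) =
      s i * s j * if i = j then C else 1 := by
    rw [traceNorm_smul, Complex.norm_real,
      Real.norm_of_nonneg (mul_nonneg (h.nonneg i) (h.nonneg j)),
      traceNorm_augment_mul_vecMulVec_mul μ ν h.orthonormal_left h.orthonormal_right]
  calc traceNorm (Q μ ν (ketBra φ))
      ≤ ∑ i, ∑ j, s i * s j * if i = j then C else 1 := by
        rw [Q_eq_augment_mul_realign_mul μ ν htrace, h.realign_ketBra]
        simp only [Matrix.mul_sum, Matrix.sum_mul, Matrix.mul_smul, Matrix.smul_mul, ← hterm]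
        exact (traceNorm_sum_le _).trans (Finset.sum_le_sum fun i _ => traceNorm_sum_le _)
    _ = ∑ i, ∑ j, (s i * s j + if i = j then (C - 1) * s i ^ 2 else 0) :=
        Finset.sum_congr rfl fun i _ => Finset.sum_congr rfl fun j _ => by
          split_ifs with hij
          · rw [hij]; ring
          · ring
    _ = (∑ i, s i) ^ 2 + (C - 1) * ∑ i, s i ^ 2 := by
        simp only [Finset.sum_add_distrib, Finset.sum_ite_eq, Finset.mem_univ, if_true,
          ← Finset.mul_sum, ← Finset.sum_mul, sq]
    _ ≤ C + (Fintype.card ι - 1) := by rw [hsq]; linarith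

theorem traceNorm_Q_ketBra_le {φ : EuclideanSpace ℂ (α × β)} (hφ : ‖φ‖ = 1) :
    traceNorm (Q μ ν (ketBra φ)) ≤
      √((‖μ‖ ^ 2 + 1) * (‖ν‖ ^ 2 + 1)) + (Fintype.card α - 1) := by
  obtain ⟨S, s, e, f, h⟩ := exists_isSchmidt φ
  refine (h.traceNorm_Q_ketBra_le μ ν hφ).trans ?_
  gcongr
  exact Fintype.card_subtype_le _

theorem traceNorm_Q_ketBra_tensorVec_le {χ : EuclideanSpace ℂ α} {ψ : EuclideanSpace ℂ β}
    (h : ‖tensorVec χ ψ‖ = 1) :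
    traceNorm (Q μ ν (ketBra (tensorVec χ ψ))) ≤ √((‖μ‖ ^ 2 + 1) * (‖ν‖ ^ 2 + 1)) := by
  have hne : tensorVec χ ψ ≠ 0 := norm_ne_zero_iff.1 (h ▸ one_ne_zero)
  have hχ : χ ≠ 0 := by rintro rfl; exact hne (by ext; simp [tensorVec])
  have hψ : ψ ≠ 0 := by rintro rfl; exact hne (by ext; simp [tensorVec])
  simpa using (isSchmidt_tensorVec hχ hψ).traceNorm_Q_ketBra_le μ ν h

end Bipartite

section Tripartite

/-- The reindexing of vectors underlying `cut2`. -/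
def cutEquiv2 (α β γ : Type*) : β × α × γ ≃ α × β × γ where
  toFun x := (x.2.1, x.1, x.2.2)
  invFun x := (x.2.1, x.1, x.2.2)

/-- The reindexing of vectors underlying `cut3`. -/
def cutEquiv3 (α β γ : Type*) : γ × α × β ≃ α × β × γ where
  toFun x := (x.2.1, x.2.2, x.1)
  invFun x := (x.2.2, x.1, x.2.1)

variable {α β γ ι : Type*}

lemma cut1_ketBra (φ : EuclideanSpace ℂ (α × β × γ)) : cut1 (ketBra φ) = ketBra φ := rfl

lemma IsProduct1.exists_eq_tensorVec {φ : EuclideanSpace ℂ (α × β × γ)} (h : IsProduct1 φ) :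
    ∃ χ ψ, φ = tensorVec χ ψ := by
  obtain ⟨χ, ψ, h⟩ := h
  exact ⟨χ, ψ, PiLp.ext fun x => h x.1 x.2.1 x.2.2⟩

variable [Fintype α] [Fintype β] [Fintype γ]

/-- The vector `φ` regrouped for the bipartition `2|13`. -/
noncomputable def vecCut2 : EuclideanSpace ℂ (α × β × γ) ≃ₗᵢ[ℂ] EuclideanSpace ℂ (β × α × γ) :=
  LinearIsometryEquiv.piLpCongrLeft 2 ℂ ℂ (cutEquiv2 α β γ).symm

/-- The vector `φ` regrouped for the bipartition `3|12`. -/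
noncomputable def vecCut3 : EuclideanSpace ℂ (α × β × γ) ≃ₗᵢ[ℂ] EuclideanSpace ℂ (γ × α × β) :=
  LinearIsometryEquiv.piLpCongrLeft 2 ℂ ℂ (cutEquiv3 α β γ).symm

lemma cut2_ketBra (φ : EuclideanSpace ℂ (α × β × γ)) : cut2 (ketBra φ) = ketBra (vecCut2 φ) := rfl

lemma cut3_ketBra (φ : EuclideanSpace ℂ (α × β × γ)) : cut3 (ketBra φ) = ketBra (vecCut3 φ) := rfl

lemma IsProduct2.exists_vecCut2_eq_tensorVec {φ : EuclideanSpace ℂ (α × β × γ)}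
    (h : IsProduct2 φ) : ∃ χ ψ, vecCut2 φ = tensorVec χ ψ := by
  obtain ⟨χ, ψ, h⟩ := h
  exact ⟨χ, ψ, PiLp.ext fun x => h x.2.1 x.1 x.2.2⟩

lemma IsProduct3.exists_vecCut3_eq_tensorVec {φ : EuclideanSpace ℂ (α × β × γ)}
    (h : IsProduct3 φ) : ∃ χ ψ, vecCut3 φ = tensorVec χ ψ := by
  obtain ⟨χ, ψ, h⟩ := h
  exact ⟨χ, ψ, PiLp.ext fun x => h x.2.1 x.2.2 x.1⟩

theorem IsBiseparable.exists_mixture {ρ : Matrix (α × β × γ) (α × β × γ) ℂ}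
    (h : IsBiseparable ρ) :
    ∃ (ι : Type) (_ : Fintype ι) (p : ι → ℝ) (φ : ι → EuclideanSpace ℂ (α × β × γ)),
      (∀ i, 0 ≤ p i) ∧ ∑ i, p i = 1 ∧ (∀ i, ‖φ i‖ = 1) ∧
      (∀ i, IsProduct1 (φ i) ∨ IsProduct2 (φ i) ∨ IsProduct3 (φ i)) ∧
      ρ = ∑ i, (p i : ℂ) • ketBra (φ i) := by
  obtain ⟨a, b, c, p, q, r, φ, ψ, ω, hφ, hψ, hω, hsum, rfl⟩ := h
  refine ⟨Fin a ⊕ Fin b ⊕ Fin c, inferInstance, Sum.elim p (Sum.elim q r),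
    Sum.elim φ (Sum.elim ψ ω), ?_, ?_, ?_, ?_, ?_⟩
  · rintro (i | i | i)
    exacts [(hφ i).1, (hψ i).1, (hω i).1]
  · simpa [add_assoc] using hsum
  · rintro (i | i | i)
    exacts [(hφ i).2.1, (hψ i).2.1, (hω i).2.1]
  · rintro (i | i | i)
    exacts [.inl (hφ i).2.2, .inr (.inl (hψ i).2.2), .inr (.inr (hω i).2.2)]
  · simp [add_assoc]

variable [DecidableEq α] [DecidableEq β] [DecidableEq γ] {n m : ℕ}
  (μ : EuclideanSpace ℝ (Fin n)) (ν : EuclideanSpace ℝ (Fin m))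

theorem avgQ_sum_ketBra_le [Fintype ι] {p : ι → ℝ} (hp : ∀ i, 0 ≤ p i) (hsum : ∑ i, p i = 1)
    {φ : ι → EuclideanSpace ℂ (α × β × γ)} (hφ : ∀ i, ‖φ i‖ = 1) :
    avgQ μ ν (∑ i, (p i : ℂ) • ketBra (φ i)) ≤ ∑ i, p i * avgQ μ ν (ketBra (φ i)) := by
  have h1 : cut1 (∑ i, (p i : ℂ) • ketBra (φ i)) = ∑ i, (p i : ℂ) • cut1 (ketBra (φ i)) := rfl
  have h2 : cut2 (∑ i, (p i : ℂ) • ketBra (φ i)) = ∑ i, (p i : ℂ) • cut2 (ketBra (φ i)) := by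
    ext; simp [cut2, Matrix.sum_apply]
  have h3 : cut3 (∑ i, (p i : ℂ) • ketBra (φ i)) = ∑ i, (p i : ℂ) • cut3 (ketBra (φ i)) := by
    ext; simp [cut3, Matrix.sum_apply]
  have hle1 := traceNorm_Q_sum_le μ ν hp hsum (σ := fun i => cut1 (ketBra (φ i)))
    fun i => by simp [cut1_ketBra, trace_ketBra, hφ]
  have hle2 := traceNorm_Q_sum_le μ ν hp hsum (σ := fun i => cut2 (ketBra (φ i)))
    fun i => by simp [cut2_ketBra, trace_ketBra, hφ]
  have hle3 := traceNorm_Q_sum_le μ ν hp hsum (σ := fun i => cut3 (ketBra (φ i)))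
    fun i => by simp [cut3_ketBra, trace_ketBra, hφ]
  rw [avgQ, h1, h2, h3]
  simp only [avgQ, mul_left_comm _ (1 / 3 : ℝ), mul_add, Finset.sum_add_distrib, ← Finset.mul_sum]
  linarith

theorem IsProduct1.avgQ_ketBra_le {φ : EuclideanSpace ℂ (α × β × γ)} (h : IsProduct1 φ)
    (hφ : ‖φ‖ = 1) :
    avgQ μ ν (ketBra φ) ≤
      √((‖μ‖ ^ 2 + 1) * (‖ν‖ ^ 2 + 1)) + (Fintype.card β + Fintype.card γ - 2) / 3 := by
  have hle2 := traceNorm_Q_ketBra_le μ ν ((vecCut2.norm_map φ).trans hφ)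
  have hle3 := traceNorm_Q_ketBra_le μ ν ((vecCut3.norm_map φ).trans hφ)
  rw [avgQ, cut1_ketBra, cut2_ketBra, cut3_ketBra]
  obtain ⟨χ, ψ, rfl⟩ := h.exists_eq_tensorVec
  have hle1 := traceNorm_Q_ketBra_tensorVec_le μ ν hφ
  linarith

theorem IsProduct2.avgQ_ketBra_le {φ : EuclideanSpace ℂ (α × β × γ)} (h : IsProduct2 φ)
    (hφ : ‖φ‖ = 1) :
    avgQ μ ν (ketBra φ) ≤
      √((‖μ‖ ^ 2 + 1) * (‖ν‖ ^ 2 + 1)) + (Fintype.card α + Fintype.card γ - 2) / 3 := by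
  have hφ2 : ‖vecCut2 φ‖ = 1 := (vecCut2.norm_map φ).trans hφ
  have hle1 := traceNorm_Q_ketBra_le μ ν hφ
  have hle3 := traceNorm_Q_ketBra_le μ ν ((vecCut3.norm_map φ).trans hφ)
  rw [avgQ, cut1_ketBra, cut2_ketBra, cut3_ketBra]
  obtain ⟨χ, ψ, hχψ⟩ := h.exists_vecCut2_eq_tensorVec
  rw [hχψ] at hφ2 ⊢
  have hle2 := traceNorm_Q_ketBra_tensorVec_le μ ν hφ2
  linarith

theorem IsProduct3.avgQ_ketBra_le {φ : EuclideanSpace ℂ (α × β × γ)} (h : IsProduct3 φ)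
    (hφ : ‖φ‖ = 1) :
    avgQ μ ν (ketBra φ) ≤
      √((‖μ‖ ^ 2 + 1) * (‖ν‖ ^ 2 + 1)) + (Fintype.card α + Fintype.card β - 2) / 3 := by
  have hφ3 : ‖vecCut3 φ‖ = 1 := (vecCut3.norm_map φ).trans hφ
  have hle1 := traceNorm_Q_ketBra_le μ ν hφ
  have hle2 := traceNorm_Q_ketBra_le μ ν ((vecCut2.norm_map φ).trans hφ)
  rw [avgQ, cut1_ketBra, cut2_ketBra, cut3_ketBra]
  obtain ⟨χ, ψ, hχψ⟩ := h.exists_vecCut3_eq_tensorVec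
  rw [hχψ] at hφ3 ⊢
  have hle3 := traceNorm_Q_ketBra_tensorVec_le μ ν hφ3
  linarith

theorem IsBiseparable.avgQ_le {ρ : Matrix (α × β × γ) (α × β × γ) ℂ} (h : IsBiseparable ρ) :
    avgQ μ ν ρ ≤ √((‖μ‖ ^ 2 + 1) * (‖ν‖ ^ 2 + 1)) +
      (Fintype.card α + Fintype.card β + Fintype.card γ
        - min (Fintype.card α : ℝ) (min (Fintype.card β) (Fintype.card γ)) - 2) / 3 := by
  obtain ⟨ι, _, p, φ, hp, hsum, hφ, hprod, rfl⟩ := h.exists_mixture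
  set K : ℝ := √((‖μ‖ ^ 2 + 1) * (‖ν‖ ^ 2 + 1)) +
    (Fintype.card α + Fintype.card β + Fintype.card γ
      - min (Fintype.card α : ℝ) (min (Fintype.card β) (Fintype.card γ)) - 2) / 3 with hK
  have hmin1 := min_le_left (Fintype.card α : ℝ) (min (Fintype.card β) (Fintype.card γ))
  have hmin := min_le_right (Fintype.card α : ℝ) (min (Fintype.card β) (Fintype.card γ))
  have hmin2 := hmin.trans (min_le_left _ _)
  have hmin3 := hmin.trans (min_le_right _ _)
  have hpure (i : ι) : avgQ μ ν (ketBra (φ i)) ≤ K := by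
    rcases hprod i with h | h | h <;> exact (h.avgQ_ketBra_le μ ν (hφ i)).trans (by linarith)
  calc avgQ μ ν (∑ i, (p i : ℂ) • ketBra (φ i))
      ≤ ∑ i, p i * avgQ μ ν (ketBra (φ i)) := avgQ_sum_ketBra_le μ ν hp hsum hφ
    _ ≤ ∑ i, p i * K := Finset.sum_le_sum fun i _ => by gcongr; exacts [hp i, hpure i]
    _ = K := by rw [← Finset.sum_mul, hsum, one_mul]

end Tripartite

end Tripartite

theorem theorem4_general {α β γ : Type*} [Fintype α] [Fintype β] [Fintype γ]
    [DecidableEq α] [DecidableEq β] [DecidableEq γ] {n m : ℕ}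
    (μ : EuclideanSpace ℝ (Fin n)) (ν : EuclideanSpace ℝ (Fin m))
    (ρ : Matrix (α × β × γ) (α × β × γ) ℂ) (hρ : Tripartite.IsState ρ) :
    (Tripartite.IsBiseparable ρ →
      Tripartite.avgQ μ ν ρ ≤ √((‖μ‖ ^ 2 + 1) * (‖ν‖ ^ 2 + 1)) +
        (Fintype.card α + Fintype.card β + Fintype.card γ
          - min (Fintype.card α : ℝ) (min (Fintype.card β) (Fintype.card γ)) - 2) / 3) ∧
    (√((‖μ‖ ^ 2 + 1) * (‖ν‖ ^ 2 + 1)) +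
        (Fintype.card α + Fintype.card β + Fintype.card γ
          - min (Fintype.card α : ℝ) (min (Fintype.card β) (Fintype.card γ)) - 2) / 3
        < Tripartite.avgQ μ ν ρ →
      Tripartite.IsGenuinelyEntangled ρ) :=
  ⟨fun h => h.avgQ_le μ ν, fun hlt => ⟨hρ, fun h => hlt.not_ge (h.avgQ_le μ ν)⟩⟩

theorem theorem4 (d n m : ℕ)
    (μ : EuclideanSpace ℝ (Fin n)) (ν : EuclideanSpace ℝ (Fin m))
    (ρ : Matrix (Fin d × Fin d × Fin d) (Fin d × Fin d × Fin d) ℂ)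
    (hρ : Tripartite.IsState ρ) :
    (Tripartite.IsBiseparable ρ →
      Tripartite.avgQ μ ν ρ
        ≤ Real.sqrt ((‖μ‖ ^ 2 + 1) * (‖ν‖ ^ 2 + 1)) + 2 * ((d : ℝ) - 1) / 3) ∧
    (Real.sqrt ((‖μ‖ ^ 2 + 1) * (‖ν‖ ^ 2 + 1)) + 2 * ((d : ℝ) - 1) / 3
        < Tripartite.avgQ μ ν ρ →
      Tripartite.IsGenuinelyEntangled ρ) := by
  have hd : 2 * ((d : ℝ) - 1) / 3 = (d + d + d - d - 2) / 3 := by ring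
  simpa [hd] using theorem4_general μ ν ρ hρ
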